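/- Let $\mathbb{T}=\mathbb{R}/\mathbb{Z}$, with normalized Lebesgue measure $du$. For a Borel probability measure $\mu$ on $\mathbb{T}$ and a continuous function $f:\mathbb{T}\to\mathbb{C}$, let $X_f=\{X_f(t):t\in\mathbb{T}\}$ be the centred, circularly symmetric complex Gaussian process (so $\mathbb{E}(X_f(t)X_f(s))=0$) with covariance $$\mathbb{E}\big(X_f(t)\overline{X_f(s)}\big)=\int_{\mathbb{T}} f(t+u)\overline{f(s+u)}\,d\mu(u),\qquad t,s\in\mathbb{T},$$ and let $\mathscr{P}(\mu)$ be the set of all continuous $f:\mathbb{T}\to\mathbb{C}$ for which $X_f$ has (a version with) almost surely bounded paths. The classical Pisier algebra is $\mathscr{P}=\mathscr{P}(du)$. **Theorem.** Let $\mu$ be a Borel probability measure on $\mathbb{T}$. If there are an interval $I\subset\mathbb{T}$ with more than one point and a constant $C>0$ such that $$\int_I g(u)\,du\le C\int_I g(u)\,d\mu(u)\quad\text{for every continuous } g\ge 0 \text{ on } \mathbb{T},$$ then $\mathscr{P}(\mu)\subset\mathscr{P}$. In particular, if $\mu$ admits a density $\varphi$ with respect to Lebesgue measure that is continuous and strictly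 positive on some nonempty open interval $I$ of $\mathbb{T}$, then $\mathscr{P}(\mu)\subset\mathscr{P}$. -/

import Mathlib

open MeasureTheory ProbabilityTheory
open scoped ENNReal ComplexConjugate

/-- `X` is a Gaussian process attached to the measure `μ` on the circle `𝕋 = ℝ/ℤ` and to the
continuous function `f`: a centred complex Gaussian process indexed by `𝕋` with
`𝔼 (X t * conj (X s)) = ∫ f (t + u) * conj (f (s + u)) dμ(u)`, and circularly symmetric, i.e.
`𝔼 (X t * X s) = 0`. These conditions determine all finite-dimensional distributions of `X`:
they are those of `∑ₙ ⟨f (t + ·), eₙ⟩ Zₙ`, with `(eₙ)` an orthonormal basis of `L²(μ, ℂ)` and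
`(Zₙ)` independent standard complex Gaussian variables. -/
structure IsPisierProcess (μ : Measure UnitAddCircle) (f : C(UnitAddCircle, ℂ))
    {Ω : Type*} [MeasurableSpace Ω] (P : Measure Ω) (X : UnitAddCircle → Ω → ℂ) : Prop where
  isGaussianProcess : IsGaussianProcess X P
  integral_eq_zero : ∀ t, ∫ ω, X t ω ∂P = 0
  integral_mul_conj : ∀ t s,
    ∫ ω, X t ω * conj (X s ω) ∂P = ∫ u, f (t + u) * conj (f (s + u)) ∂μ
  integral_mul : ∀ t s, ∫ ω, X t ω * X s ω ∂P = 0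

/-- The class `𝒫(μ)` of the continuous functions `f` on the circle whose Gaussian process `X_f`
has almost surely bounded paths. As usual for processes with uncountable index set, which are
given only up to modification, this means that some version of the process (a process with the
same finite-dimensional distributions) has almost surely bounded paths. -/
def pisierClass (μ : Measure UnitAddCircle) : Set C(UnitAddCircle, ℂ) :=
  {f | ∃ (Ω : Type) (_ : MeasurableSpace Ω) (P : Measure Ω) (X : UnitAddCircle → Ω → ℂ),
    IsProbabilityMeasure P ∧ IsPisierProcess μ f P X ∧
      ∀ᵐ ω ∂P, ∃ M : ℝ, ∀ t, ‖X t ω‖ ≤ M}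

/-- The classical Pisier algebra: the class `𝒫(μ)` for `μ` the Lebesgue measure on the circle
(of total mass one). -/
def classicalPisierAlgebra : Set C(UnitAddCircle, ℂ) :=
  pisierClass (volume : Measure UnitAddCircle)

/-- A nondegenerate interval (open, closed or half-open) of the circle `ℝ/ℤ`: the image of an
interval of `ℝ` with more than one point. -/
def IsCircleInterval (I : Set UnitAddCircle) : Prop :=
  ∃ J : Set ℝ, J.OrdConnected ∧ J.Nontrivial ∧ I = (fun x : ℝ => (x : UnitAddCircle)) '' J

/-! The core is that `𝒫(ρ) ⊆ 𝒫(ν)` whenever `ν ≤ ρ` (`pisierClass_antitone`). Take independent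
processes `Y` and `Z` attached to `ν` and `ρ - ν`. Since `Z` is symmetric, `Y + Z` and `Y - Z` are
both attached to `ρ`, so both are bounded as soon as one process attached to `ρ` is, and `2Y = (Y +
Z) + (Y - Z)` is bounded too. No comparison inequality for Gaussian processes is needed.

The class is also stable under scaling the measure (multiply the process by a constant), under
translating it (shift the time parameter), and under sums of measures (add independent processes).
The hypothesis gives `volume.restrict U ≤ c • μ` for some nonempty open `U`, so `𝒫(μ)` lies in the
class of `volume.restrict U`. By compactness finitely many translates of `U` cover the circle, and
Lebesgue measure is invariant, so this class lies in that of `volume`.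

Two facts about Gaussian processes support this. Processes exist for every finite measure, via an
isonormal process on `L²(ν, ℂ)` regarded as a real Hilbert space. Boundedness does not depend on the
chosen realization: on a countable dense set it is a property of the finite-dimensional laws, and
`L²` continuity allows a bounded modification to be built from there. -/

/-! ### Isonormal processes on real Hilbert spaces. -/

/-- The characteristic function of a real square integrable random variable depends continuously
on the variable, in `L²`. -/
theorem continuous_integral_exp_mul_I {Ω : Type*} [MeasurableSpace Ω] (P : Measure Ω)
    [IsProbabilityMeasure P] (t : ℝ) :
    Continuous fun g : Lp ℝ 2 P => ∫ ω, Complex.exp (t * g ω * Complex.I) ∂P := by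
  have hint (g : Lp ℝ 2 P) : Integrable (fun ω => Complex.exp (t * g ω * Complex.I)) P := by
    refine Integrable.of_bound (C := 1) ?_ (ae_of_all _ fun ω => ?_)
    · have := (Lp.aestronglyMeasurable g).aemeasurable
      exact AEMeasurable.aestronglyMeasurable (by fun_prop)
    · rw [← Complex.ofReal_mul, Complex.norm_exp_ofReal_mul_I]
  refine LipschitzWith.continuous (K := ‖t‖₊) (LipschitzWith.of_dist_le_mul fun g h => ?_)
  rw [dist_eq_norm, ← integral_sub (hint g) (hint h)]
  have hgh : MemLp (fun ω => g ω - h ω) 2 P := (Lp.memLp g).sub (Lp.memLp h)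
  calc
    _ ≤ ∫ ω, |t| * |g ω - h ω| ∂P := by
      refine norm_integral_le_of_norm_le ((hgh.integrable one_le_two).abs.const_mul _)
        (ae_of_all _ fun ω => ?_)
      have : Complex.exp (t * g ω * Complex.I) - Complex.exp (t * h ω * Complex.I)
          = Complex.exp ((t * h ω : ℝ) * Complex.I)
            * (Complex.exp (Complex.I * (t * (g ω - h ω) : ℝ)) - 1) := by
        rw [mul_sub, ← Complex.exp_add, mul_one]
        congr 2 <;> push_cast <;> ring
      rw [this, norm_mul, Complex.norm_exp_ofReal_mul_I, one_mul, ← abs_mul]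
      exact Real.norm_exp_I_mul_ofReal_sub_one_le
    _ = |t| * ∫ ω, |g ω - h ω| ∂P := integral_const_mul _ _
    _ ≤ |t| * dist g h := by
      gcongr
      rw [dist_eq_norm, Lp.norm_def]
      have h1 : eLpNorm (↑↑(g - h)) 2 P = eLpNorm (fun ω => g ω - h ω) 2 P :=
        eLpNorm_congr_ae (Lp.coeFn_sub g h)
      rw [h1]
      have h2 := eLpNorm_le_eLpNorm_of_exponent_le (p := 1) (q := 2) one_le_two
        hgh.aestronglyMeasurable
      have h3 := ENNReal.toReal_mono hgh.eLpNorm_ne_top h2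
      rw [eLpNorm_one_eq_lintegral_enorm, ← integral_norm_eq_lintegral_enorm
        hgh.aestronglyMeasurable] at h3
      exact h3

/-- Characteristic functions turn Gaussianity into equations between quantities that are continuous
in `L²`; closedness of the set of Gaussian variables follows. -/
theorem map_eq_gaussianReal_iff_integral_exp {Ω : Type*} [MeasurableSpace Ω] {P : Measure Ω}
    [IsProbabilityMeasure P] {X : Ω → ℝ} (hX : AEMeasurable X P) {v : NNReal} :
    P.map X = gaussianReal 0 v ↔
      ∀ t : ℝ, ∫ ω, Complex.exp (t * X ω * Complex.I) ∂P = Complex.exp (-(v * t ^ 2 / 2)) := by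
  have key (t : ℝ) : charFun (P.map X) t = ∫ ω, Complex.exp (t * X ω * Complex.I) ∂P := by
    rw [charFun_apply_real, integral_map hX (by fun_prop)]
  have := Measure.isProbabilityMeasure_map hX
  constructor
  · intro h t
    rw [← key, h, charFun_gaussianReal]
    simp
  · intro h
    refine Measure.ext_of_charFun (funext fun t => ?_)
    rw [key, h, charFun_gaussianReal]
    simp

/-- The square integrable random variables with law `𝒩(0, ‖g‖²)` form a closed subset of `L²`. -/
theorem isClosed_setOf_map_eq_gaussianReal {Ω : Type*} [MeasurableSpace Ω] (P : Measure Ω)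
    [IsProbabilityMeasure P] :
    IsClosed {g : Lp ℝ 2 P | P.map g = gaussianReal 0 (‖g‖₊ ^ 2)} := by
  have (g : Lp ℝ 2 P) := map_eq_gaussianReal_iff_integral_exp (v := ‖g‖₊ ^ 2)
    (Lp.aestronglyMeasurable g).aemeasurable
  simp_rw [this, Set.ofPred_forall]
  refine isClosed_iInter fun t => isClosed_eq (continuous_integral_exp_mul_I P t) ?_
  push_cast
  fun_prop

/-- **Isonormal process**: a real Hilbert space embeds isometrically in a Gaussian Hilbert space. -/
theorem exists_isonormal (H : Type) [NormedAddCommGroup H] [InnerProductSpace ℝ H]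
    [CompleteSpace H] :
    ∃ (Ω : Type) (_ : MeasurableSpace Ω) (P : Measure Ω) (_ : IsProbabilityMeasure P)
      (ξ : H →ₗᵢ[ℝ] Lp ℝ 2 P), ∀ h, P.map (ξ h) = gaussianReal 0 (‖h‖₊ ^ 2) := by
  obtain ⟨w, b, -⟩ := exists_hilbertBasis ℝ H
  let P : Measure (w → ℝ) := Measure.infinitePi fun _ => gaussianReal 0 1
  have hind : iIndepFun (fun (i : w) (ω : w → ℝ) => ω i) P :=
    iIndepFun_infinitePi (X := fun _ x => x) fun _ => measurable_id
  have hlaw (i : w) : P.map (fun ω : w → ℝ => ω i) = gaussianReal 0 1 :=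
    Measure.infinitePi_map_eval _ i
  have hmeas (i : w) : AEMeasurable (fun ω : w → ℝ => ω i) P :=
    (measurable_pi_apply i).aemeasurable
  have hG (i : w) : HasGaussianLaw (fun ω : w → ℝ => ω i) P := ⟨by rw [hlaw]; infer_instance⟩
  have hmean (i : w) : ∫ ω : w → ℝ, ω i ∂P = 0 := by
    have := integral_map (μ := P) (φ := fun ω : w → ℝ => ω i) (f := fun x : ℝ => x)
      (hmeas i) (by fun_prop)
    rw [← this, hlaw]
    exact integral_id_gaussianReal
  have hvar (i : w) : ∫ ω : w → ℝ, ω i * ω i ∂P = 1 := by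
    have h1 : Var[fun ω : w → ℝ => ω i; P] = 1 := by
      have := variance_map (μ := P) (Y := fun ω : w → ℝ => ω i) (X := id) (by fun_prop)
        (hmeas i)
      rw [hlaw, variance_id_gaussianReal] at this
      simpa using this.symm
    rw [variance_of_integral_eq_zero (hmeas i) (hmean i)] at h1
    simpa [sq] using h1
  let Z (i : w) : Lp ℝ 2 P := (hG i).memLp_two.toLp
  have hZ (i : w) : Z i =ᵐ[P] fun ω => ω i := (hG i).memLp_two.coeFn_toLp
  have hinner (i j : w) : inner ℝ (Z i) (Z j) = ∫ ω : w → ℝ, ω i * ω j ∂P := by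
    rw [L2.inner_def]
    refine integral_congr_ae ?_
    filter_upwards [hZ i, hZ j] with ω h1 h2
    rw [h1, h2]
    simp [mul_comm]
  have hon : Orthonormal ℝ Z := by
    classical
    rw [orthonormal_iff_ite]
    intro i j
    rw [hinner]
    split_ifs with hij
    · subst hij; exact hvar i
    · rw [(hind.indepFun hij).integral_fun_mul_eq_mul_integral
        (hmeas i).aestronglyMeasurable (hmeas j).aestronglyMeasurable,
        hmean, zero_mul]
  let ξ : H →ₗᵢ[ℝ] Lp ℝ 2 P :=
    hon.orthogonalFamily.linearIsometry.comp b.repr.toLinearIsometry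
  have hξb (i : w) : ξ (b i) = Z i := by
    classical
    change hon.orthogonalFamily.linearIsometry (b.repr (b i)) = Z i
    rw [b.repr_self, OrthogonalFamily.linearIsometry_apply_single]
    simp
  refine ⟨w → ℝ, inferInstance, P, inferInstance, ξ, ?_⟩
  -- The law is computed on finite combinations of basis vectors, where independence of the
  -- coordinates gives joint Gaussianity; closedness extends it to all of `H` by density.
  have hclosed : IsClosed {h : H | P.map (ξ h) = gaussianReal 0 (‖h‖₊ ^ 2)} := by
    have := (isClosed_setOf_map_eq_gaussianReal P).preimage ξ.continuous
    simpa [Set.preimage, ξ.nnnorm_map] using this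
  have hspan (h : H) (hh : h ∈ Submodule.span ℝ (Set.range b)) :
      P.map (ξ h) = gaussianReal 0 (‖h‖₊ ^ 2) := by
    obtain ⟨c, rfl⟩ := Finsupp.mem_span_range_iff_exists_finsupp.1 hh
    set h := c.sum fun i a => a • b i
    have hsum : ξ h =ᵐ[P] fun ω => ∑ i : c.support, c i * ω i := by
      have h1 : ξ h = ∑ i : c.support, c i • Z i := by
        simp only [h, Finsupp.sum, map_sum, map_smul, hξb]
        exact (Finset.sum_coe_sort c.support fun i => c i • Z i).symm
      rw [h1]
      refine (Lp.coeFn_finsetSum _ _).trans ?_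
      have h2 : ∀ᵐ ω ∂P, ∀ i : c.support, (c i • Z i : Lp ℝ 2 P) ω = c i * ω i := by
        rw [ae_all_iff]
        intro i
        filter_upwards [Lp.coeFn_smul (c i) (Z i), hZ i] with ω h3 h4
        rw [h3, Pi.smul_apply, h4, smul_eq_mul]
      filter_upwards [h2] with ω h2
      simp [h2]
    have hg : HasGaussianLaw (ξ h) P := by
      have hi : iIndepFun (fun (i : c.support) (ω : w → ℝ) => ω i) P :=
        hind.precomp Subtype.val_injective
      have hj := (iIndepFun.hasGaussianLaw (ι := c.support) (X := fun i (ω : w → ℝ) => ω i)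
        (fun i => hG i) hi)
      have hk := hj.map_fun (∑ i : c.support, c i • ContinuousLinearMap.proj (R := ℝ) i)
      refine hk.congr (hsum.symm.mono fun ω hω => ?_)
      rw [← hω]
      simp
    have hm : ∫ ω, ξ h ω ∂P = 0 := by
      rw [integral_congr_ae hsum, integral_finsetSum]
      · simp [integral_const_mul, hmean]
      · exact fun i _ => (hG i).integrable.const_mul _
    have hv : Var[ξ h; P] = ‖h‖ ^ 2 := by
      rw [variance_of_integral_eq_zero hg.aemeasurable hm, ← ξ.norm_map,
        ← real_inner_self_eq_norm_sq, L2.inner_def]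
      simp [sq]
    rw [hg.map_eq_gaussianReal, hm, hv]
    congr 1
    ext
    simp
  intro h
  have : h ∈ closure (Submodule.span ℝ (Set.range b) : Set H) := by
    rw [← Submodule.topologicalClosure_coe, b.dense_span]; trivial
  exact closure_minimal (fun h hh => hspan h hh) hclosed this

/-- An isonormal process is a Gaussian process. -/
theorem isGaussianProcess_of_map_eq_gaussianReal {H Ω : Type*} [NormedAddCommGroup H]
    [InnerProductSpace ℝ H] [MeasurableSpace Ω] {P : Measure Ω} (ξ : H →ₗᵢ[ℝ] Lp ℝ 2 P)
    (hξ : ∀ h, P.map (ξ h) = gaussianReal 0 (‖h‖₊ ^ 2)) :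
    IsGaussianProcess (fun h ω => ξ h ω) P where
  hasGaussianLaw I := by
    classical
    have hm (h : H) : AEMeasurable (ξ h) P := (Lp.aestronglyMeasurable (ξ h)).aemeasurable
    have hmI : AEMeasurable (fun ω => I.restrict fun h => ξ h ω) P :=
      aemeasurable_pi_lambda _ fun i => hm i
    refine ⟨isGaussian_of_isGaussian_map fun L => ?_⟩
    rw [AEMeasurable.map_map_of_aemeasurable (by fun_prop) hmI]
    -- By linearity of `ξ`, every linear functional of a finite subfamily is again a single variable
    -- `ξ h`, whose law is known.
    have key : (L ∘ fun ω => I.restrict fun h => ξ h ω) =ᵐ[P]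
        ξ (∑ i : I, L (Pi.single i 1) • (i : H)) := by
      have h1 : ξ (∑ i : I, L (Pi.single i 1) • (i : H))
          = ∑ i : I, L (Pi.single i 1) • ξ (i : H) := by simp only [map_sum, map_smul]
      rw [h1]
      have h2 : ∀ᵐ ω ∂P, ∀ i : I,
          (L (Pi.single i 1) • ξ (i : H) : Lp ℝ 2 P) ω = L (Pi.single i 1) * ξ (i : H) ω := by
        rw [ae_all_iff]
        intro i
        filter_upwards [Lp.coeFn_smul (L (Pi.single i 1)) (ξ (i : H))] with ω h3
        rw [h3, Pi.smul_apply, smul_eq_mul]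
      filter_upwards [h2, Lp.coeFn_finsetSum Finset.univ
        fun i : I => L (Pi.single i 1) • ξ (i : H)] with ω h2 h3
      rw [h3, Function.comp_apply]
      conv_lhs => rw [← Finset.univ_sum_single (I.restrict fun h => ξ h ω), map_sum]
      rw [Finset.sum_apply]
      refine Finset.sum_congr rfl fun i _ => ?_
      rw [h2 i, mul_comm, ← smul_eq_mul, ← map_smul, ← Pi.single_smul]
      simp
    rw [Measure.map_congr key, hξ]
    infer_instance

/-! ### Existence of the process attached to `ν` and `f`. -/

/-- The kernel of the process attached to `ν` and `f`. -/
noncomputable def pisierKernel (ν : Measure UnitAddCircle) (f : C(UnitAddCircle, ℂ))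
    (t s : UnitAddCircle) : ℂ :=
  ∫ u, f (t + u) * conj (f (s + u)) ∂ν

theorem integrable_pisierKernel (ν : Measure UnitAddCircle) [IsFiniteMeasure ν]
    (f : C(UnitAddCircle, ℂ)) (t s : UnitAddCircle) :
    Integrable (fun u => f (t + u) * conj (f (s + u))) ν :=
  Continuous.integrable_of_hasCompactSupport (by fun_prop) (HasCompactSupport.of_compactSpace _)

theorem continuous_pisierKernel (ν : Measure UnitAddCircle) [IsFiniteMeasure ν]
    (f : C(UnitAddCircle, ℂ)) :
    Continuous fun p : UnitAddCircle × UnitAddCircle => pisierKernel ν f p.1 p.2 := by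
  have := continuous_parametric_integral_of_continuous (μ := ν)
    (f := fun (p : UnitAddCircle × UnitAddCircle) u => f (p.1 + u) * conj (f (p.2 + u)))
    (by fun_prop) (s := Set.univ) isCompact_univ
  simpa [pisierKernel] using this

/-- For every finite measure `ν` and every continuous `f` there is a Gaussian process attached to
`ν` and `f`. -/
theorem exists_isPisierProcess (ν : Measure UnitAddCircle) [IsFiniteMeasure ν]
    (f : C(UnitAddCircle, ℂ)) :
    ∃ (Ω : Type) (_ : MeasurableSpace Ω) (P : Measure Ω) (X : UnitAddCircle → Ω → ℂ),
      IsProbabilityMeasure P ∧ IsPisierProcess ν f P X := by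
  obtain ⟨Ω, _, P, _, ξ, hξ⟩ := exists_isonormal (Lp ℂ 2 ν)
  have hmem (c : ℂ) (t : UnitAddCircle) : MemLp (fun u => c * f (t + u)) 2 ν :=
    Continuous.memLp_of_hasCompactSupport (by fun_prop) (HasCompactSupport.of_compactSpace _)
  let F (c : ℂ) (t : UnitAddCircle) : Lp ℂ 2 ν := (hmem c t).toLp
  have hF (c d : ℂ) (t s : UnitAddCircle) :
      inner ℝ (F c t) (F d s) = (c * conj d * pisierKernel ν f t s).re := by
    have h1 : inner ℝ (F c t) (F d s)
        = ∫ u, (c * conj d * (f (t + u) * conj (f (s + u)))).re ∂ν := by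
      rw [L2.inner_def]
      refine integral_congr_ae ?_
      filter_upwards [(hmem c t).coeFn_toLp, (hmem d s).coeFn_toLp] with u h1 h2
      rw [h1, h2, Complex.inner]
      simp
      ring
    have h2 : Integrable (fun u => c * conj d * (f (t + u) * conj (f (s + u)))) ν :=
      (integrable_pisierKernel ν f t s).const_mul _
    rw [h1, pisierKernel, ← integral_const_mul]
    exact integral_re h2
  have hint (g h : Lp ℂ 2 ν) : Integrable (fun ω => ξ g ω * ξ h ω) P :=
    (Lp.memLp (ξ g)).integrable_mul (Lp.memLp (ξ h))
  have hcov (g h : Lp ℂ 2 ν) : ∫ ω, ξ g ω * ξ h ω ∂P = inner ℝ g h := by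
    rw [← ξ.inner_map_map, L2.inner_def]
    simp [mul_comm]
  have hmean (g : Lp ℂ 2 ν) : ∫ ω, ξ g ω ∂P = 0 := by
    have := integral_map (μ := P) (φ := ξ g) (f := fun x : ℝ => x)
      (Lp.aestronglyMeasurable (ξ g)).aemeasurable (by fun_prop)
    rw [← this, hξ]
    exact integral_id_gaussianReal
  -- With `f_t = f (t + ·)`, the process is `ξ(f_t/√2) + i ξ(-i f_t/√2)`. The real inner product on
  -- `L²(ν, ℂ)` is the real part of the Hermitian one, so each part has covariance `Re K / 2`, and
  -- the mixed covariances are `± Im K / 2`. These values add up to `K` in `𝔼(X X̄)` and cancel in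
  -- `𝔼(X X)`.
  let r : ℂ := ((√2)⁻¹ : ℝ)
  have hr : r * r = 1 / 2 := by
    simp only [r]
    rw [← Complex.ofReal_mul, ← mul_inv, Real.mul_self_sqrt zero_le_two]
    norm_num
  have hr' : conj r = r := Complex.conj_ofReal _
  let p := F r
  let q := F (-Complex.I * r)
  have hre (z : ℂ) : (1 / 2 * z).re = z.re / 2 := by
    simp [Complex.mul_re]; ring
  have hpp (t s) : inner ℝ (p t) (p s) = (pisierKernel ν f t s).re / 2 := by
    rw [hF, hr', hr, hre]
  have hqq (t s) : inner ℝ (q t) (q s) = (pisierKernel ν f t s).re / 2 := by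
    rw [hF, map_mul, hr', map_neg, Complex.conj_I, ← hre, ← hr]
    congr 1
    linear_combination (- pisierKernel ν f t s * r * r) * Complex.I_mul_I
  have hqp (t s) : inner ℝ (q t) (p s) = (pisierKernel ν f t s).im / 2 := by
    rw [hF, hr', mul_assoc (-Complex.I), hr]
    simp [Complex.mul_re]
    ring
  have hpq (t s) : inner ℝ (p t) (q s) = - (pisierKernel ν f t s).im / 2 := by
    rw [hF, map_mul, hr', map_neg, Complex.conj_I, mul_left_comm, hr]
    simp [Complex.mul_re]
    ring
  refine ⟨Ω, inferInstance, P, fun t ω => (ξ (p t) ω : ℂ) + ξ (q t) ω * Complex.I, inferInstance,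
    ?_, ?_, ?_, ?_⟩
  · have hξG := isGaussianProcess_of_map_eq_gaussianReal ξ hξ
    refine IsGaussianProcess.of_isGaussianProcess hξG fun t => ?_
    classical
    refine ⟨{p t, q t}, Complex.ofRealCLM ∘L ContinuousLinearMap.proj ⟨p t, by simp⟩
      + Complex.I • (Complex.ofRealCLM ∘L ContinuousLinearMap.proj ⟨q t, by simp⟩), fun ω => ?_⟩
    simp [mul_comm]
  · intro t
    have h1 (g : Lp ℂ 2 ν) : Integrable (fun ω => (ξ g ω : ℂ)) P :=
      ((Lp.memLp (ξ g)).integrable one_le_two).ofReal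
    rw [integral_add (h1 _) ((h1 _).mul_const _), integral_mul_const, integral_complex_ofReal,
      integral_complex_ofReal, hmean, hmean]
    simp
  · intro t s
    change _ = pisierKernel ν f t s
    have h1 : (fun ω => ((ξ (p t) ω : ℂ) + ξ (q t) ω * Complex.I)
          * conj ((ξ (p s) ω : ℂ) + ξ (q s) ω * Complex.I))
        = fun ω => ((ξ (p t) ω * ξ (p s) ω + ξ (q t) ω * ξ (q s) ω : ℝ) : ℂ)
          + ((ξ (q t) ω * ξ (p s) ω - ξ (p t) ω * ξ (q s) ω : ℝ) : ℂ) * Complex.I := by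
      ext ω
      simp only [map_add, map_mul, Complex.conj_ofReal, Complex.conj_I]
      push_cast
      linear_combination (- (ξ (q t) ω * ξ (q s) ω : ℂ)) * Complex.I_mul_I
    rw [h1, integral_add ((hint _ _).add (hint _ _)).ofReal
      (((hint _ _).sub (hint _ _)).ofReal.mul_const _), integral_mul_const,
      integral_complex_ofReal, integral_complex_ofReal, integral_add (hint _ _) (hint _ _),
      integral_sub (hint _ _) (hint _ _)]
    simp only [hcov, hpp, hqq, hpq, hqp]
    conv_rhs => rw [← Complex.re_add_im (pisierKernel ν f t s)]
    congr 3 <;> ring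
  · intro t s
    have h1 : (fun ω => ((ξ (p t) ω : ℂ) + ξ (q t) ω * Complex.I)
          * ((ξ (p s) ω : ℂ) + ξ (q s) ω * Complex.I))
        = fun ω => ((ξ (p t) ω * ξ (p s) ω - ξ (q t) ω * ξ (q s) ω : ℝ) : ℂ)
          + ((ξ (q t) ω * ξ (p s) ω + ξ (p t) ω * ξ (q s) ω : ℝ) : ℂ) * Complex.I := by
      ext ω
      push_cast
      linear_combination ((ξ (q t) ω * ξ (q s) ω : ℂ)) * Complex.I_mul_I
    rw [h1, integral_add ((hint _ _).sub (hint _ _)).ofReal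
      (((hint _ _).add (hint _ _)).ofReal.mul_const _), integral_mul_const,
      integral_complex_ofReal, integral_complex_ofReal, integral_sub (hint _ _) (hint _ _),
      integral_add (hint _ _) (hint _ _)]
    simp only [hcov, hpp, hqq, hpq, hqp]
    simp [neg_div]

/-! ### Uniqueness in law, and transfer of boundedness on countable sets. -/

/-- A real linear functional on finite families of complex numbers. -/
theorem exists_forall_eq_sum_re {ι : Type*} [Fintype ι] (L : (ι → ℂ) →L[ℝ] ℝ) :
    ∃ c : ι → ℂ, ∀ x, L x = ∑ i, (c i * x i).re := by
  classical
  refine ⟨fun i => L (Pi.single i 1) - L (Pi.single i Complex.I) * Complex.I, fun x => ?_⟩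
  conv_lhs => rw [← Finset.univ_sum_single x, map_sum]
  refine Finset.sum_congr rfl fun i _ => ?_
  have : Pi.single i (x i) = (x i).re • (Pi.single i 1 : ι → ℂ)
      + (x i).im • (Pi.single i Complex.I : ι → ℂ) := by
    rw [← Pi.single_smul, ← Pi.single_smul, ← Pi.single_add]
    congr 1
    simp
  rw [this, map_add, map_smul, map_smul]
  simp [Complex.mul_re]
  ring

namespace IsPisierProcess

variable {ν : Measure UnitAddCircle} {f : C(UnitAddCircle, ℂ)} {Ω Ω' : Type*}
  [MeasurableSpace Ω] [MeasurableSpace Ω'] {P : Measure Ω} {P' : Measure Ω'}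
  {X : UnitAddCircle → Ω → ℂ} {X' : UnitAddCircle → Ω' → ℂ}

theorem memLp_two (hX : IsPisierProcess ν f P X) (t : UnitAddCircle) : MemLp (X t) 2 P :=
  (hX.isGaussianProcess.hasGaussianLaw_eval t).memLp_two

theorem integrable (hX : IsPisierProcess ν f P X) (t : UnitAddCircle) : Integrable (X t) P :=
  (hX.isGaussianProcess.hasGaussianLaw_eval t).integrable

theorem memLp_two_conj (hX : IsPisierProcess ν f P X) (t : UnitAddCircle) :
    MemLp (fun ω => conj (X t ω)) 2 P :=
  (hX.memLp_two t).star

theorem integrable_mul (hX : IsPisierProcess ν f P X) (t s : UnitAddCircle) :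
    Integrable (fun ω => X t ω * X s ω) P :=
  (hX.memLp_two t).integrable_mul (hX.memLp_two s)

theorem integrable_mul_conj (hX : IsPisierProcess ν f P X) (t s : UnitAddCircle) :
    Integrable (fun ω => X t ω * conj (X s ω)) P :=
  (hX.memLp_two t).integrable_mul (hX.memLp_two_conj s)

/-- From `2 Re z Re w = Re (z w̄) + Re (z w)`: circular symmetry kills the second term, so the
kernel alone determines all real covariances. -/
theorem integral_re_mul_re (hX : IsPisierProcess ν f P X) (t s : UnitAddCircle) (c d : ℂ) :
    ∫ ω, (c * X t ω).re * (d * X s ω).re ∂P = (c * conj d * pisierKernel ν f t s).re / 2 := by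
  have h1 : (fun ω => (c * X t ω).re * (d * X s ω).re)
      = fun ω => (c * conj d / 2 * (X t ω * conj (X s ω)) + c * d / 2 * (X t ω * X s ω)).re := by
    ext ω
    simp [Complex.mul_re, Complex.mul_im]
    ring
  have h2 := (hX.integrable_mul_conj t s).const_mul (c * conj d / 2)
  have h3 := (hX.integrable_mul t s).const_mul (c * d / 2)
  rw [h1]
  refine (integral_re (h2.add h3)).trans ?_
  change (∫ ω, c * conj d / 2 * (X t ω * conj (X s ω)) + c * d / 2 * (X t ω * X s ω) ∂P).re = _
  rw [integral_add h2 h3, integral_const_mul, integral_const_mul, hX.integral_mul,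
    hX.integral_mul_conj, mul_zero, add_zero, div_mul_eq_mul_div]
  exact Complex.div_ofNat_re _ 2

theorem integral_variance_dual (hX : IsPisierProcess ν f P X) {I : Finset UnitAddCircle}
    (L : (I → ℂ) →L[ℝ] ℝ) (c : I → ℂ) (hc : ∀ x, L x = ∑ i, (c i * x i).re) :
    ∫ ω, (L ∘ fun ω => I.restrict (X · ω)) ω ∂P = 0 ∧
    Var[L ∘ fun ω => I.restrict (X · ω); P]
      = ∑ i, ∑ j, (c i * conj (c j) * pisierKernel ν f i j).re / 2 := by
  have hre (i : I) : MemLp (fun ω => (c i * X i ω).re) 2 P :=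
    ((hX.memLp_two i).const_mul (c i)).re
  have h0 := (hX.isGaussianProcess.hasGaussianLaw I).isProbabilityMeasure
  have hLX : (L ∘ fun ω => I.restrict (X · ω)) = fun ω => ∑ i, (c i * X i ω).re := by
    ext ω; simp [hc]
  have hmean : ∫ ω, (L ∘ fun ω => I.restrict (X · ω)) ω ∂P = 0 := by
    rw [hLX, integral_finsetSum _ fun i _ => (hre i).integrable one_le_two]
    refine Finset.sum_eq_zero fun i _ => ?_
    refine (integral_re ((hX.integrable i).const_mul (c i))).trans ?_
    rw [integral_const_mul, hX.integral_eq_zero]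
    simp
  refine ⟨hmean, ?_⟩
  rw [variance_of_integral_eq_zero _ hmean, hLX]
  · simp_rw [sq, Finset.sum_mul_sum]
    rw [integral_finsetSum]
    · refine Finset.sum_congr rfl fun i _ => ?_
      rw [integral_finsetSum]
      · exact Finset.sum_congr rfl fun j _ => hX.integral_re_mul_re _ _ _ _
      · exact fun j _ => (hre i).integrable_mul (hre j)
    · exact fun i _ => integrable_finsetSum _ fun j _ => (hre i).integrable_mul (hre j)
  · rw [hLX]
    exact (memLp_finsetSum _ fun i _ => hre i).aestronglyMeasurable.aemeasurable

/-- A Gaussian law is determined by the mean and variance of its real linear functionals, and here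
these depend only on the kernel. -/
theorem map_restrict_eq (hX : IsPisierProcess ν f P X) (hX' : IsPisierProcess ν f P' X')
    (I : Finset UnitAddCircle) :
    P.map (fun ω => I.restrict (X · ω)) = P'.map (fun ω => I.restrict (X' · ω)) := by
  have hG := hX.isGaussianProcess.hasGaussianLaw I
  have hG' := hX'.isGaussianProcess.hasGaussianLaw I
  have := hG.isProbabilityMeasure
  have := hG'.isProbabilityMeasure
  have := hG.isGaussian_map
  have := hG'.isGaussian_map
  refine Measure.ext_of_charFunDual (funext fun L => ?_)
  obtain ⟨c, hc⟩ := exists_forall_eq_sum_re L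
  rw [hG.charFunDual_map_eq, hG'.charFunDual_map_eq, (hX.integral_variance_dual L c hc).1,
    (hX'.integral_variance_dual L c hc).1, (hX.integral_variance_dual L c hc).2,
    (hX'.integral_variance_dual L c hc).2]

/-- Both laws are projective limits of the same finite-dimensional marginals, and such a limit is
unique. -/
theorem map_countable_eq (hX : IsPisierProcess ν f P X) (hX' : IsPisierProcess ν f P' X')
    (D : Set UnitAddCircle) [Countable D] :
    P.map (fun ω (d : D) => X d ω) = P'.map (fun ω (d : D) => X' d ω) := by
  have := hX.isGaussianProcess.isProbabilityMeasure
  have hm : AEMeasurable (fun ω (d : D) => X d ω) P :=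
    aemeasurable_pi_lambda _ fun d => hX.isGaussianProcess.aemeasurable d
  have hm' : AEMeasurable (fun ω (d : D) => X' d ω) P' :=
    aemeasurable_pi_lambda _ fun d => hX'.isGaussianProcess.aemeasurable d
  have h1 := isProjectiveLimit_map (X := fun (d : D) => X d) hm
  have h2 := isProjectiveLimit_map (X := fun (d : D) => X' d) hm'
  have h3 (I : Finset D) : P.map (fun ω => I.restrict fun d : D => X d ω)
      = P'.map (fun ω => I.restrict fun d : D => X' d ω) := by
    classical
    have h4 := hX.map_restrict_eq hX' (I.image Subtype.val)
    let r : (I.image Subtype.val → ℂ) → I → ℂ :=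
      fun x i => x ⟨i, Finset.mem_image_of_mem _ i.2⟩
    have hr : Measurable r := by fun_prop
    have h5 := congrArg (Measure.map r) h4
    rwa [AEMeasurable.map_map_of_aemeasurable hr.aemeasurable,
      AEMeasurable.map_map_of_aemeasurable hr.aemeasurable] at h5
    · exact aemeasurable_pi_lambda _ fun d => hX'.isGaussianProcess.aemeasurable d
    · exact aemeasurable_pi_lambda _ fun d => hX.isGaussianProcess.aemeasurable d
  simp_rw [h3] at h1
  have (I : Finset D) : IsFiniteMeasure (P'.map (fun ω => I.restrict fun d : D => X' d ω)) := by
    rw [← h3]; infer_instance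
  exact h1.unique h2

/-- Boundedness on a countable set depends only on the measure and the function. -/
theorem ae_bounded_of_ae_bounded (hX : IsPisierProcess ν f P X)
    (hX' : IsPisierProcess ν f P' X') {D : Set UnitAddCircle} (hD : D.Countable)
    (h : ∀ᵐ ω ∂P, ∃ M : ℝ, ∀ d ∈ D, ‖X d ω‖ ≤ M) :
    ∀ᵐ ω ∂P', ∃ M : ℝ, ∀ d ∈ D, ‖X' d ω‖ ≤ M := by
  have := hD.to_subtype
  have hS : MeasurableSet {x : D → ℂ | ∃ M : ℝ, ∀ d, ‖x d‖ ≤ M} := by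
    have : {x : D → ℂ | ∃ M : ℝ, ∀ d, ‖x d‖ ≤ M} = ⋃ n : ℕ, ⋂ d : D, {x : D → ℂ | ‖x d‖ ≤ n} := by
      ext x
      simp only [Set.mem_ofPred_eq, Set.mem_iUnion, Set.mem_iInter]
      refine ⟨fun ⟨M, hM⟩ => ?_, fun ⟨n, hn⟩ => ⟨n, hn⟩⟩
      obtain ⟨n, hn⟩ := exists_nat_ge M
      exact ⟨n, fun d => (hM d).trans hn⟩
    rw [this]
    exact MeasurableSet.iUnion fun n => MeasurableSet.iInter fun d =>
      measurableSet_le (by fun_prop) (by fun_prop)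
  have hm : AEMeasurable (fun ω (d : D) => X d ω) P :=
    aemeasurable_pi_lambda _ fun d => hX.isGaussianProcess.aemeasurable d
  have hm' : AEMeasurable (fun ω (d : D) => X' d ω) P' :=
    aemeasurable_pi_lambda _ fun d => hX'.isGaussianProcess.aemeasurable d
  have h1 : ∀ᵐ x ∂(P.map fun ω (d : D) => X d ω), x ∈ {x : D → ℂ | ∃ M : ℝ, ∀ d, ‖x d‖ ≤ M} := by
    refine (ae_map_iff hm hS).2 ?_
    filter_upwards [h] with ω ⟨M, hM⟩ using ⟨M, fun d => hM d d.2⟩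
  rw [hX.map_countable_eq hX'] at h1
  filter_upwards [(ae_map_iff hm' hS).1 h1] with ω ⟨M, hM⟩ using ⟨M, fun d hd => hM ⟨d, hd⟩⟩

theorem congr (hX : IsPisierProcess ν f P X) {Y : UnitAddCircle → Ω → ℂ}
    (hXY : ∀ t, X t =ᵐ[P] Y t) : IsPisierProcess ν f P Y where
  isGaussianProcess := hX.isGaussianProcess.congr hXY
  integral_eq_zero t := by rw [← hX.integral_eq_zero t, integral_congr_ae (hXY t)]
  integral_mul_conj t s := by
    rw [← hX.integral_mul_conj t s]
    refine integral_congr_ae ?_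
    filter_upwards [hXY t, hXY s] with ω h1 h2
    rw [h1, h2]
  integral_mul t s := by
    rw [← hX.integral_mul t s]
    refine integral_congr_ae ?_
    filter_upwards [hXY t, hXY s] with ω h1 h2
    rw [h1, h2]

/-! ### Mean-square continuity and bounded versions. -/

theorem integral_norm_sub_sq (hX : IsPisierProcess ν f P X) (t s : UnitAddCircle) :
    ∫ ω, ‖X t ω - X s ω‖ ^ 2 ∂P = (pisierKernel ν f t t - pisierKernel ν f t s
      - pisierKernel ν f s t + pisierKernel ν f s s).re := by
  have h1 : (fun ω => ‖X t ω - X s ω‖ ^ 2) = fun ω => (X t ω * conj (X t ω) - X t ω * conj (X s ω)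
      - X s ω * conj (X t ω) + X s ω * conj (X s ω)).re := by
    ext ω
    rw [← Complex.ofReal_re (‖X t ω - X s ω‖ ^ 2), Complex.ofReal_pow, ← Complex.mul_conj', map_sub]
    congr 1
    ring
  have h := hX.integrable_mul_conj
  have h3 : Integrable (fun ω => X t ω * conj (X t ω) - X t ω * conj (X s ω)) P :=
    (h t t).sub (h t s)
  have h4 : Integrable (fun ω => X t ω * conj (X t ω) - X t ω * conj (X s ω)
      - X s ω * conj (X t ω)) P := h3.sub (h s t)
  have h2 := h4.add (h s s)
  rw [h1]
  refine (integral_re h2).trans ?_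
  change (∫ ω, X t ω * conj (X t ω) - X t ω * conj (X s ω)
      - X s ω * conj (X t ω) + X s ω * conj (X s ω) ∂P).re = _
  rw [integral_add h4 (h s s), integral_sub h3 (h s t), integral_sub (h t t) (h t s)]
  simp only [hX.integral_mul_conj, pisierKernel]

/-- The kernel is continuous, so `𝔼 |X s - X t|²` tends to `0` as `s → t`. -/
theorem tendstoInMeasure [IsFiniteMeasure ν] (hX : IsPisierProcess ν f P X)
    {t : UnitAddCircle} {d : ℕ → UnitAddCircle} (hd : Filter.Tendsto d .atTop (nhds t)) :
    TendstoInMeasure P (fun n => X (d n)) .atTop (X t) := by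
  refine tendstoInMeasure_of_tendsto_eLpNorm (p := 2) two_ne_zero
    (fun n => (hX.memLp_two _).aestronglyMeasurable) (hX.memLp_two _).aestronglyMeasurable ?_
  have h1 (n : ℕ) : eLpNorm (X (d n) - X t) 2 P
      = ENNReal.ofReal ((∫ ω, ‖X (d n) ω - X t ω‖ ^ (2 : ℝ) ∂P) ^ (2 : ℝ)⁻¹) :=
    ((hX.memLp_two (d n)).sub (hX.memLp_two t)).eLpNorm_eq_integral_rpow_norm two_ne_zero
      ENNReal.ofNat_ne_top
  have h2 : Filter.Tendsto (fun n => ∫ ω, ‖X (d n) ω - X t ω‖ ^ (2 : ℝ) ∂P) .atTop (nhds 0) := by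
    simp_rw [Real.rpow_two, hX.integral_norm_sub_sq]
    have hK := continuous_pisierKernel ν f
    have hc : Continuous fun s => (pisierKernel ν f s s - pisierKernel ν f s t
        - pisierKernel ν f t s + pisierKernel ν f t t).re := by
      have a := hK.comp (continuous_id.prodMk continuous_id)
      have b := hK.comp (continuous_id.prodMk (continuous_const (y := t)))
      have c := hK.comp ((continuous_const (y := t)).prodMk continuous_id)
      exact Complex.continuous_re.comp (((a.sub b).sub c).add continuous_const)
    have := (hc.tendsto t).comp hd
    simpa [Function.comp_def] using this
  simp_rw [h1]
  have h3 := h2.rpow_const (p := (2 : ℝ)⁻¹) (Or.inr (by norm_num))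
  rw [Real.zero_rpow (by norm_num)] at h3
  simpa using ENNReal.tendsto_ofReal h3

/-- A process which is almost surely bounded on a countable dense set has a version with almost
surely bounded paths. -/
theorem mem_pisierClass_of_ae_bounded [IsFiniteMeasure ν] {Ω : Type} [MeasurableSpace Ω]
    {P : Measure Ω} {X : UnitAddCircle → Ω → ℂ} (hX : IsPisierProcess ν f P X)
    {D : Set UnitAddCircle} (hD : Dense D)
    (h : ∀ᵐ ω ∂P, ∃ M : ℝ, ∀ d ∈ D, ‖X d ω‖ ≤ M) : f ∈ pisierClass ν := by
  classical
  -- `Y` keeps the value of `X` exactly when it respects every bound valid on `D`. At a fixed `t`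
  -- this holds almost surely, because `X t` is the almost sure limit of values along a sequence in
  -- `D`.
  let Y (t : UnitAddCircle) (ω : Ω) : ℂ :=
    if ∀ M : ℝ, (∀ d ∈ D, ‖X d ω‖ ≤ M) → ‖X t ω‖ ≤ M then X t ω else 0
  have hXY (t : UnitAddCircle) : X t =ᵐ[P] Y t := by
    obtain ⟨d, hdD, hdt⟩ := mem_closure_iff_seq_limit.1 (hD t)
    obtain ⟨n, -, hn⟩ := (hX.tendstoInMeasure hdt).exists_seq_tendsto_ae
    filter_upwards [hn] with ω hω
    refine (if_pos fun M hM => ?_).symm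
    exact le_of_tendsto hω.norm (Filter.Eventually.of_forall fun i => hM _ (hdD _))
  refine ⟨Ω, inferInstance, P, Y, hX.isGaussianProcess.isProbabilityMeasure, hX.congr hXY, ?_⟩
  filter_upwards [h] with ω ⟨M, hM⟩
  refine ⟨M, fun t => ?_⟩
  obtain ⟨d, hd⟩ := hD.nonempty
  by_cases ht : ∀ M : ℝ, (∀ d ∈ D, ‖X d ω‖ ≤ M) → ‖X t ω‖ ≤ M
  · simpa only [Y, if_pos ht] using ht M hM
  · simpa only [Y, if_neg ht, norm_zero] using (norm_nonneg _).trans (hM d hd)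

/-! ### Operations on processes and the corresponding operations on measures. -/

theorem neg (hX : IsPisierProcess ν f P X) : IsPisierProcess ν f P fun t ω => -X t ω where
  isGaussianProcess := by simpa using hX.isGaussianProcess.smul fun _ => -1
  integral_eq_zero t := by rw [MeasureTheory.integral_neg, hX.integral_eq_zero, neg_zero]
  integral_mul_conj t s := by simpa using hX.integral_mul_conj t s
  integral_mul t s := by simpa using hX.integral_mul t s

theorem smul (hX : IsPisierProcess ν f P X) (c : NNReal) :
    IsPisierProcess (c • ν) f P fun t ω => √c • X t ω where
  isGaussianProcess := hX.isGaussianProcess.smul _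
  integral_eq_zero t := by rw [MeasureTheory.integral_smul, hX.integral_eq_zero, smul_zero]
  integral_mul_conj t s := by
    have (ω : Ω) : √c • X t ω * conj (√c • X s ω) = (c : ℝ) • (X t ω * conj (X s ω)) := by
      have h : (√c : ℂ) * √c = (c : ℝ) := by
        rw [← Complex.ofReal_mul, Real.mul_self_sqrt c.coe_nonneg]
      simp only [Complex.real_smul, map_mul, Complex.conj_ofReal]
      linear_combination (X t ω * conj (X s ω)) * h
    simp_rw [this]
    rw [MeasureTheory.integral_smul, hX.integral_mul_conj, integral_smul_nnreal_measure]
    rfl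
  integral_mul t s := by
    simp_rw [smul_mul_smul_comm]
    rw [MeasureTheory.integral_smul, hX.integral_mul, smul_zero]

theorem translate (hX : IsPisierProcess ν f P X) (a : UnitAddCircle) :
    IsPisierProcess (ν.map (a + ·)) f P fun t => X (t + a) where
  isGaussianProcess := hX.isGaussianProcess.comp_right (· + a)
  integral_eq_zero t := hX.integral_eq_zero _
  integral_mul_conj t s := by
    rw [hX.integral_mul_conj, integral_map (by fun_prop)
      (Continuous.aestronglyMeasurable (by fun_prop))]
    simp only [add_assoc]
  integral_mul t s := hX.integral_mul _ _

/-- On the product space the summands are independent and centred, so the cross terms vanish and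
covariances add. -/
theorem add {ν' : Measure UnitAddCircle} [IsFiniteMeasure ν] [IsFiniteMeasure ν']
    (hX : IsPisierProcess ν f P X)
    (hX' : IsPisierProcess ν' f P' X') :
    IsPisierProcess (ν + ν') f (P.prod P') fun t ω => X t ω.1 + X' t ω.2 := by
  have := hX.isGaussianProcess.isProbabilityMeasure
  have := hX'.isGaussianProcess.isProbabilityMeasure
  have i1 {g : Ω → ℂ} (hg : Integrable g P) : Integrable (fun ω => g ω.1) (P.prod P') :=
    hg.comp_fst P'
  have i2 {g : Ω' → ℂ} (hg : Integrable g P') : Integrable (fun ω => g ω.2) (P.prod P') :=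
    hg.comp_snd P
  have e1 (g : Ω → ℂ) : ∫ ω, g ω.1 ∂P.prod P' = ∫ ω, g ω ∂P := by simp [integral_fun_fst]
  have e2 (g : Ω' → ℂ) : ∫ ω, g ω.2 ∂P.prod P' = ∫ ω, g ω ∂P' := by simp [integral_fun_snd]
  have cross (x y : Ω → ℂ) (x' y' : Ω' → ℂ) (hx : Integrable x P) (hy : Integrable y P)
      (hx' : Integrable x' P') (hy' : Integrable y' P') (h : Integrable (fun ω => x ω * y ω) P)
      (h' : Integrable (fun ω => x' ω * y' ω) P') (hx0 : ∫ ω, x ω ∂P = 0)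
      (hx0' : ∫ ω, x' ω ∂P' = 0) :
      ∫ ω, (x ω.1 + x' ω.2) * (y ω.1 + y' ω.2) ∂P.prod P'
        = ∫ ω, x ω * y ω ∂P + ∫ ω, x' ω * y' ω ∂P' := by
    have j1 := hx.mul_prod hy'
    have j2 := hy.mul_prod hx'
    have : (fun ω : Ω × Ω' => (x ω.1 + x' ω.2) * (y ω.1 + y' ω.2)) = fun ω =>
        (x ω.1 * y ω.1 + x' ω.2 * y' ω.2) + (x ω.1 * y' ω.2 + y ω.1 * x' ω.2) := by
      ext ω; ring
    have k1 : Integrable (fun ω : Ω × Ω' => x ω.1 * y ω.1 + x' ω.2 * y' ω.2) (P.prod P') :=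
      (i1 h).add (i2 h')
    have k2 : Integrable (fun ω : Ω × Ω' => x ω.1 * y' ω.2 + y ω.1 * x' ω.2) (P.prod P') :=
      j1.add j2
    rw [this, integral_add k1 k2, integral_add (i1 h) (i2 h'),
      integral_add j1 j2, integral_prod_mul, integral_prod_mul, hx0, hx0',
      e1 fun ω => x ω * y ω, e2 fun ω => x' ω * y' ω]
    simp
  have iconj {g : Ω → ℂ} (hg : Integrable g P) : Integrable (fun ω => conj (g ω)) P :=
    (LinearIsometryEquiv.integrable_comp_iff Complex.conjLIE).2 hg
  have iconj' {g : Ω' → ℂ} (hg : Integrable g P') : Integrable (fun ω => conj (g ω)) P' :=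
    (LinearIsometryEquiv.integrable_comp_iff Complex.conjLIE).2 hg
  refine ⟨⟨fun I => ?_⟩, fun t => ?_, fun t s => ?_, fun t s => ?_⟩
  · have h1 := hX.isGaussianProcess.hasGaussianLaw I
    have h2 := hX'.isGaussianProcess.hasGaussianLaw I
    have hfst : HasGaussianLaw (fun ω : Ω × Ω' => I.restrict (X · ω.1)) (P.prod P') := by
      refine ⟨?_⟩
      have := h1.isGaussian_map
      rwa [← (measurePreserving_fst (μ := P) (ν := P')).map_eq,
        AEMeasurable.map_map_of_aemeasurable _ measurable_fst.aemeasurable] at this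
      rw [(measurePreserving_fst (μ := P) (ν := P')).map_eq]
      exact h1.aemeasurable
    have hsnd : HasGaussianLaw (fun ω : Ω × Ω' => I.restrict (X' · ω.2)) (P.prod P') := by
      refine ⟨?_⟩
      have := h2.isGaussian_map
      rwa [← (measurePreserving_snd (μ := P) (ν := P')).map_eq,
        AEMeasurable.map_map_of_aemeasurable _ measurable_snd.aemeasurable] at this
      rw [(measurePreserving_snd (μ := P) (ν := P')).map_eq]
      exact h2.aemeasurable
    exact (IndepFun.hasGaussianLaw hfst hsnd
      (indepFun_prod₀ h1.aemeasurable h2.aemeasurable)).add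
  · rw [integral_add (i1 (hX.integrable t)) (i2 (hX'.integrable t)), e1, e2,
      hX.integral_eq_zero, hX'.integral_eq_zero, add_zero]
  · simp only [map_add]
    rw [cross (X t) (fun ω => conj (X s ω)) (X' t) (fun ω => conj (X' s ω)) (hX.integrable t)
      (iconj (hX.integrable s)) (hX'.integrable t) (iconj' (hX'.integrable s))
      (hX.integrable_mul_conj t s) (hX'.integrable_mul_conj t s) (hX.integral_eq_zero t)
      (hX'.integral_eq_zero t), hX.integral_mul_conj, hX'.integral_mul_conj,
      integral_add_measure (integrable_pisierKernel ν f t s) (integrable_pisierKernel ν' f t s)]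
  · rw [cross (X t) (X s) (X' t) (X' s) (hX.integrable t) (hX.integrable s) (hX'.integrable t)
      (hX'.integrable s) (hX.integrable_mul t s) (hX'.integrable_mul t s) (hX.integral_eq_zero t)
      (hX'.integral_eq_zero t), hX.integral_mul, hX'.integral_mul, add_zero]

end IsPisierProcess

/-! ### Monotonicity and stability of the classes; covering the circle. -/

/-- The class `𝒫(ν)` decreases with `ν`: if `Y` and `Z` are independent processes attached to `ν`
and `ρ - ν`, then `Y + Z` and `Y - Z` are attached to `ρ`. -/
theorem pisierClass_antitone {ν ρ : Measure UnitAddCircle} [IsFiniteMeasure ρ] (h : ν ≤ ρ) :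
    pisierClass ρ ⊆ pisierClass ν := by
  rintro f ⟨Ω, _, P, X, _, hX, hb⟩
  have : IsFiniteMeasure ν := isFiniteMeasure_of_le ρ h
  obtain ⟨Ω₁, _, P₁, Y, _, hY⟩ := exists_isPisierProcess ν f
  obtain ⟨Ω₂, _, P₂, Z, _, hZ⟩ := exists_isPisierProcess (ρ - ν) f
  obtain ⟨D, hDc, hDd⟩ := TopologicalSpace.exists_countable_dense UnitAddCircle
  have hadd := hY.add hZ
  have hsub := hY.add hZ.neg
  rw [add_comm, Measure.sub_add_cancel_of_le h] at hadd hsub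
  have hbD : ∀ᵐ ω ∂P, ∃ M : ℝ, ∀ d ∈ D, ‖X d ω‖ ≤ M := by
    filter_upwards [hb] with ω ⟨M, hM⟩ using ⟨M, fun d _ => hM d⟩
  have h1 := hX.ae_bounded_of_ae_bounded hadd hDc hbD
  have h2 := hX.ae_bounded_of_ae_bounded hsub hDc hbD
  have h3 : ∀ᵐ ω ∂P₁.prod P₂, ∃ M : ℝ, ∀ d ∈ D, ‖Y d ω.1‖ ≤ M := by
    filter_upwards [h1, h2] with ω ⟨M, hM⟩ ⟨N, hN⟩
    refine ⟨M + N, fun d hd => ?_⟩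
    have h4 : (2 : ℂ) * Y d ω.1 = (Y d ω.1 + Z d ω.2) + (Y d ω.1 + -Z d ω.2) := by ring
    have h5 : 2 * ‖Y d ω.1‖ ≤ M + N := by
      calc 2 * ‖Y d ω.1‖ = ‖(2 : ℂ) * Y d ω.1‖ := by simp
        _ ≤ _ := by rw [h4]; exact norm_add_le_of_le (hM d hd) (hN d hd)
    linarith [norm_nonneg (Y d ω.1)]
  refine hY.mem_pisierClass_of_ae_bounded hDd ?_
  filter_upwards [Measure.ae_ae_of_ae_prod h3] with ω hω
  exact hω.exists.choose_spec

theorem pisierClass_subset_smul (ν : Measure UnitAddCircle) (c : NNReal) :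
    pisierClass ν ⊆ pisierClass (c • ν) := by
  rintro f ⟨Ω, _, P, X, hP, hX, hb⟩
  refine ⟨Ω, _, P, _, hP, hX.smul c, ?_⟩
  filter_upwards [hb] with ω ⟨M, hM⟩
  refine ⟨√c * M, fun t => ?_⟩
  rw [norm_smul, Real.norm_of_nonneg (Real.sqrt_nonneg _)]
  exact mul_le_mul_of_nonneg_left (hM t) (Real.sqrt_nonneg _)

theorem pisierClass_subset_translate (ν : Measure UnitAddCircle) (a : UnitAddCircle) :
    pisierClass ν ⊆ pisierClass (ν.map (a + ·)) := by
  rintro f ⟨Ω, _, P, X, hP, hX, hb⟩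
  refine ⟨Ω, _, P, _, hP, hX.translate a, ?_⟩
  filter_upwards [hb] with ω ⟨M, hM⟩ using ⟨M, fun t => hM _⟩

theorem inter_pisierClass_subset_add (ν ν' : Measure UnitAddCircle) [IsFiniteMeasure ν]
    [IsFiniteMeasure ν'] : pisierClass ν ∩ pisierClass ν' ⊆ pisierClass (ν + ν') := by
  rintro f ⟨⟨Ω, _, P, X, hP, hX, hb⟩, ⟨Ω', _, P', X', hP', hX', hb'⟩⟩
  refine ⟨Ω × Ω', _, P.prod P', _, inferInstance, hX.add hX', ?_⟩
  filter_upwards [Measure.quasiMeasurePreserving_fst.ae hb,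
    Measure.quasiMeasurePreserving_snd.ae hb'] with ω ⟨M, hM⟩ ⟨N, hN⟩
  exact ⟨M + N, fun t => norm_add_le_of_le (hM t) (hN t)⟩

/-- Finitely many translates of a nonempty open set cover the circle. -/
theorem pisierClass_restrict_subset_classicalPisierAlgebra {U : Set UnitAddCircle}
    (hU : IsOpen U) (hne : U.Nonempty) :
    pisierClass ((volume : Measure UnitAddCircle).restrict U) ⊆ classicalPisierAlgebra := by
  intro f hf
  -- `V a` is the translate `a + U`; by invariance, translating `volume.restrict U` by `a` gives
  -- `volume.restrict (V a)`.
  let V (a : UnitAddCircle) : Set UnitAddCircle := (-a + ·) ⁻¹' U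
  have hVo (a) : IsOpen (V a) := hU.preimage (by fun_prop)
  have hV (a) : f ∈ pisierClass (volume.restrict (V a)) := by
    have h1 := (measurePreserving_add_left (volume : Measure UnitAddCircle) a).restrict_preimage
      (hVo a).measurableSet
    have h2 : (a + ·) ⁻¹' V a = U := by ext x; simp [V]
    rw [h2] at h1
    rw [← h1.map_eq]
    exact pisierClass_subset_translate _ a hf
  have hfin (s : Finset UnitAddCircle) : f ∈ pisierClass (volume.restrict (⋃ a ∈ s, V a)) := by
    classical
    induction s using Finset.induction_on with
    | empty =>
      exact pisierClass_antitone (by simpa using Measure.zero_le _) hf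
    | insert a s _ ih =>
      rw [Finset.set_biUnion_insert]
      -- Overlaps between translates do no harm: the restriction to a union is at most the sum of
      -- the restrictions, and the class is antitone.
      exact pisierClass_antitone (Measure.restrict_union_le _ _)
        (inter_pisierClass_subset_add _ _ ⟨hV a, ih⟩)
  obtain ⟨u, hu⟩ := hne
  obtain ⟨s, hs⟩ := isCompact_univ.elim_finite_subcover V hVo fun x _ =>
    Set.mem_iUnion.2 ⟨x - u, by simpa [V] using hu⟩
  have := hfin s
  rwa [Set.univ_subset_iff.1 hs, Measure.restrict_univ] at this

theorem pisierClass_subset_classicalPisierAlgebra {μ : Measure UnitAddCircle} [IsFiniteMeasure μ]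
    {U : Set UnitAddCircle} (hU : IsOpen U) (hne : U.Nonempty) (c : NNReal)
    (h : (volume : Measure UnitAddCircle).restrict U ≤ c • μ) :
    pisierClass μ ⊆ classicalPisierAlgebra :=
  (pisierClass_subset_smul μ c).trans <| (pisierClass_antitone h).trans <|
    pisierClass_restrict_subset_classicalPisierAlgebra hU hne

/-! ### Comparison of measures, and the theorem. -/

/-- Finite measures on a compact space are compared by integrating continuous functions. -/
theorem measure_le_of_forall_integral_le {X : Type*} [TopologicalSpace X] [CompactSpace X]
    [HasOuterApproxClosed X] [MeasurableSpace X] [BorelSpace X] {m₁ m₂ : Measure X}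
    [IsFiniteMeasure m₁] [m₁.WeaklyRegular] [IsFiniteMeasure m₂]
    (h : ∀ g : C(X, ℝ), (∀ x, 0 ≤ g x) → ∫ x, g x ∂m₁ ≤ ∫ x, g x ∂m₂) : m₁ ≤ m₂ := by
  -- The indicator of a closed set is a limit of continuous functions; inner regularity of `m₁` by
  -- closed sets then reaches all measurable sets.
  have hF (F : Set X) (hF : IsClosed F) : m₁ F ≤ m₂ F := by
    refine le_of_tendsto_of_tendsto' (HasOuterApproxClosed.tendsto_lintegral_apprSeq hF m₁)
      (HasOuterApproxClosed.tendsto_lintegral_apprSeq hF m₂) fun n => ?_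
    have hi (m : Measure X) [IsFiniteMeasure m] :
        Integrable (fun x => (hF.apprSeq n x : ℝ)) m :=
      Continuous.integrable_of_hasCompactSupport (by fun_prop) (HasCompactSupport.of_compactSpace _)
    rw [lintegral_coe_eq_integral _ (hi m₁), lintegral_coe_eq_integral _ (hi m₂)]
    exact ENNReal.ofReal_le_ofReal
      (h ⟨fun x => (hF.apprSeq n x : ℝ), by fun_prop⟩ fun x => NNReal.coe_nonneg _)
  refine Measure.le_iff.2 fun A hA => ?_
  rw [hA.measure_eq_iSup_isClosed_of_ne_top (measure_ne_top _ _)]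
  exact iSup_le fun K => iSup_le fun hK => iSup_le fun hc =>
    (hF K hc).trans (measure_mono hK)

/-- The open set `U` supplies the translates that cover the circle; the compact set `K` is where a
continuous density attains a positive minimum. -/
theorem IsCircleInterval.exists_isOpen_subset_isCompact {I : Set UnitAddCircle}
    (hI : IsCircleInterval I) :
    ∃ U K : Set UnitAddCircle, IsOpen U ∧ U.Nonempty ∧ U ⊆ K ∧ IsCompact K ∧ K ⊆ I := by
  obtain ⟨J, hJ, ⟨x, hx, y, hy, hxy⟩, rfl⟩ := hI
  wlog hlt : x < y generalizing x y
  · exact this y hy x hx hxy.symm (lt_of_le_of_ne (not_lt.1 hlt) hxy.symm)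
  refine ⟨(fun x : ℝ => (x : UnitAddCircle)) '' Set.Ioo x y,
    (fun x : ℝ => (x : UnitAddCircle)) '' Set.Icc x y,
    QuotientAddGroup.isOpenMap_coe _ isOpen_Ioo, (Set.nonempty_Ioo.2 hlt).image _,
    Set.image_mono Set.Ioo_subset_Icc_self,
    isCompact_Icc.image (AddCircle.continuous_mk' 1), Set.image_mono (hJ.out hx hy)⟩

theorem restrict_le_smul_withDensity {α : Type*} [MeasurableSpace α] (m : Measure α)
    {φ : α → ℝ≥0∞} {U : Set α} (hU : MeasurableSet U) {δ : NNReal} (hδ : δ ≠ 0)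
    (h : ∀ u ∈ U, δ ≤ φ u) : m.restrict U ≤ δ⁻¹ • m.withDensity φ := by
  refine Measure.le_iff.2 fun A hA => ?_
  have h1 : δ * m (A ∩ U) ≤ m.withDensity φ A := by
    calc δ * m (A ∩ U) = ∫⁻ _ in A ∩ U, δ ∂m := by rw [setLIntegral_const]
      _ ≤ ∫⁻ u in A ∩ U, φ u ∂m := setLIntegral_mono' (hA.inter hU) fun u hu => h u hu.2
      _ = m.withDensity φ (A ∩ U) := (withDensity_apply _ (hA.inter hU)).symm
      _ ≤ _ := measure_mono Set.inter_subset_left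
  rw [Measure.restrict_apply hA, Measure.smul_apply, ENNReal.smul_def, smul_eq_mul,
    ENNReal.coe_inv hδ]
  calc m (A ∩ U) = (δ : ℝ≥0∞)⁻¹ * (δ * m (A ∩ U)) := by
        rw [← mul_assoc, ENNReal.inv_mul_cancel (by simpa) ENNReal.coe_ne_top, one_mul]
    _ ≤ _ := by gcongr

theorem theorem2 (μ : Measure UnitAddCircle) [IsProbabilityMeasure μ] :
    (∀ (I : Set UnitAddCircle) (C : ℝ), IsCircleInterval I → 0 < C →
      (∀ g : C(UnitAddCircle, ℝ), (∀ u, 0 ≤ g u) →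
        ∫ u in I, g u ≤ C * ∫ u in I, g u ∂μ) →
      pisierClass μ ⊆ classicalPisierAlgebra) ∧
    (∀ (I : Set UnitAddCircle) (φ : UnitAddCircle → ℝ≥0∞), IsCircleInterval I → IsOpen I →
      AEMeasurable φ (volume : Measure UnitAddCircle) →
      μ = (volume : Measure UnitAddCircle).withDensity φ →
      ContinuousOn φ I → (∀ u ∈ I, 0 < φ u) →
      pisierClass μ ⊆ classicalPisierAlgebra) := by
  refine ⟨fun I C hI hC h => ?_, fun I φ hI _ _ hμ hφ hpos => ?_⟩
  · obtain ⟨U, K, hU, hne, hUK, -, hKI⟩ := hI.exists_isOpen_subset_isCompact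
    refine pisierClass_subset_classicalPisierAlgebra hU hne C.toNNReal ?_
    have h1 : (volume : Measure UnitAddCircle).restrict I ≤ C.toNNReal • μ.restrict I := by
      refine measure_le_of_forall_integral_le fun g hg => (h g hg).trans_eq ?_
      rw [integral_smul_nnreal_measure, NNReal.smul_def, Real.coe_toNNReal _ hC.le, smul_eq_mul]
    refine (Measure.restrict_mono (hUK.trans hKI) le_rfl).trans (h1.trans ?_)
    gcongr
    exact Measure.restrict_le_self
  · obtain ⟨U, K, hU, hne, hUK, hK, hKI⟩ := hI.exists_isOpen_subset_isCompact
    obtain ⟨x, hx, hmin⟩ := hK.exists_isMinOn (hne.mono hUK) (hφ.mono hKI)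
    -- The minimum of `φ` on `K` could be `∞`, so a finite `δ` strictly between `0` and it is used
    -- instead.
    obtain ⟨δ, hδ0, hδ⟩ := ENNReal.lt_iff_exists_nnreal_btwn.1 (hpos x (hKI hx))
    refine pisierClass_subset_classicalPisierAlgebra hU hne δ⁻¹ ?_
    rw [hμ]
    exact restrict_le_smul_withDensity _ hU.measurableSet (by simpa using hδ0.ne')
      fun u hu => hδ.le.trans (hmin (hUK hu))
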